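/- **Theorem.** Let $m\equiv 1 \pmod 4$ be a prime, and let $A,B,C$ be pairwise coprime integers such that $$A^2=m(B^2+C^2),\qquad 2\mid B,\qquad A+B\equiv 1 \pmod 4 .$$ Then for every odd prime $p>0$ with $\left(\frac{m}{p}\right)=+1$, $$\left(\frac{A+B\sqrt m}{p}\right)=\left(\frac{p}{m}\right)_4 .$$ Here $\left(\frac{p}{m}\right)_4$ is $+1$ if $p$ is a fourth power modulo $m$, and $-1$ otherwise. The left-hand side is the quadratic residue symbol $\left(\frac{A+B\sqrt m}{\mathfrak p}\right)$ for any prime ideal $\mathfrak p$ above $p$ in the ring of integers of $k=\mathbb Q(\sqrt m)$; the equation holds for each of them. For $\alpha\notin\mathfrak p$ the symbol $\left(\frac{\alpha}{\mathfrak p}\right)$ is $+1$ or $-1$ according as $\alpha$ is a square modulo $\mathfrak p$ or not; for $\alpha\in\mathfrak p$ it is $\left(\frac{\beta}{\mathfrak p}\right)$ for any integer $\beta\notin\mathfrak p$ of $k$ with $\beta\in\alpha\,(k^{\times})^2$, and $0$ if there is no such $\beta$. In elementary terms, for every integer $s$ with $s^2\equiv m \pmod p$ and $p\nmid A+Bs$,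 the Legendre symbol satisfies $$\left(\frac{A+Bs}{p}\right)=\left(\frac{p}{m}\right)_4 .$$ Such an $s$ always exists, and if $p\nmid C$ then every $s$ with $s^2\equiv m\pmod p$ satisfies $p\nmid A+Bs$. In particular the primes $p$ dividing $ABC$ are included. -/

import Mathlib

/-- The rational quartic residue symbol `(a/m)_4` for a prime `m ≡ 1 mod 4` and an integer `a` that
is a quadratic residue modulo `m` (it is used only for such `a`): `+1` if `a` is a fourth power
modulo `m`, and `-1` otherwise; `0` if `m ∣ a`. -/
noncomputable def quarticSymbol (a : ℤ) (m : ℕ) : ℤ :=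
  open Classical in
  if (a : ZMod m) = 0 then 0
  else if ∃ x : ZMod m, x ^ 4 = (a : ZMod m) then 1
  else -1

/-- `α` and `β` lie in the same square class of the fraction field: `α γ² = β δ²` with
`γ, δ` nonzero. -/
def SameSquareClass {R : Type*} [CommRing R] (α β : R) : Prop :=
  ∃ γ δ : R, γ ≠ 0 ∧ δ ≠ 0 ∧ α * γ ^ 2 = β * δ ^ 2

/-- The quadratic residue symbol `(α/P)` for a prime ideal `P` of odd residue characteristic in the
ring of integers `R` of a number field. For `α ∉ P` it is `+1` or `-1` according as `α` is a square
modulo `P` or not. It depends only on the square class of `α`, so it extends to those `α ∈ P` whose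
square class contains an element `β ∉ P`, by `(α/P) = (β/P)`. It is `0` for all other `α`.
Thus it is `1`, `-1`, `0` according as `P` splits, is inert, or ramifies in `k(√α)`, for `α ≠ 0`. -/
noncomputable def quadraticSymbol {R : Type*} [CommRing R] (P : Ideal R) (α : R) : ℤ :=
  open Classical in
  if ∃ β : R, SameSquareClass α β ∧ β ∉ P ∧ IsSquare (Ideal.Quotient.mk P β) then 1
  else if ∃ β : R, SameSquareClass α β ∧ β ∉ P then -1
  else 0

/-! In an algebraically closed field of characteristic `p` containing `s = √m`, the element `A + B
s` has an explicit square root `ω` built from quartic Gauss sums, and Frobenius multiplies `ω` by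
`(p/m)_4`. Euler's criterion then gives the claim, with no condition on `p ∣ ABC` beyond `A + B s ≠
0`.

Let `χ` be a quartic character mod `m` with `J(χ, χ) = a + b i`. Then `g(χ)² = (a + b i) s` after
fixing signs, and `g(χ) g(χ⁻¹) = ε m` with `ε = χ(-1)`. Suitable combinations `γ, δ` of the two sums
satisfy `γ² = ε m + b s`, `δ² = ε m - b s`, `γ δ = a s`, and are Frobenius eigenvectors
(`exists_quartic_radicals`).

Writing `A = m D` turns the hypothesis into `m D² = B² + C²`. Factoring in the Gaussian integers
gives `|D| = r² + t²`, `B = b (r² - t²) + 2 a r t` (`exists_sq_add_sq_of_mul_sq_eq`), and `A + B ≡ 1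
mod 4` forces the sign of `D` to be `ε`. Hence `(r γ + t δ)² = A + B s`.

For a prime ideal `P` above `p` the residue field is `𝔽_p`. If `A + B√m` lies in `P`, its conjugate
does not, and it has the same square class because the norm is `m C² = (C√m)²`. -/

/-! ### Quartic characters modulo `m`. -/

theorem GaussianInt.isPrimitiveRoot_I : IsPrimitiveRoot (⟨0, 1⟩ : GaussianInt) 4 := by
  refine IsPrimitiveRoot.mk_of_lt _ (by norm_num) (by decide) fun l h0 h4 => ?_
  interval_cases l <;> decide

/-- A character is determined by its value at a generator `g`. So `χ (g ^ n) = 1` forces `χ ^ n =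
1`, and the order of `χ` divides `n`. -/
theorem MulChar.apply_eq_one_iff_exists_pow {F R : Type*} [Field F] [Finite F] [CommRing R]
    (χ : MulChar F R) {x : F} (hx : x ≠ 0) :
    χ x = 1 ↔ ∃ y, y ^ orderOf χ = x := by
  constructor
  · intro h
    obtain ⟨g, hg⟩ := IsCyclic.exists_generator (α := Fˣ)
    obtain ⟨n, hn : g ^ n = _⟩ := mem_powers_iff_mem_zpowers.mpr (hg (Units.mk0 x hx))
    have hχ : χ ^ n = 1 := by
      rw [MulChar.eq_iff hg, MulChar.pow_apply_coe, ← map_pow, ← Units.val_pow_eq_pow_val, hn,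
        Units.val_mk0, h, MulChar.one_apply_coe]
    obtain ⟨k, rfl⟩ := orderOf_dvd_of_pow_eq_one hχ
    refine ⟨(g ^ k : Fˣ), ?_⟩
    rw [← Units.val_pow_eq_pow_val, ← pow_mul, mul_comm k, hn, Units.val_mk0]
  · rintro ⟨y, rfl⟩
    have hy : y ≠ 0 := by
      rintro rfl
      exact hx (zero_pow (MulChar.orderOf_pos χ).ne')
    rw [map_pow, ← MulChar.pow_apply' χ (MulChar.orderOf_pos χ).ne', pow_orderOf_eq_one,
      MulChar.one_apply hy.isUnit]

/-- The sign `(-1) ^ ((m - 1) / 4)` for `m ≡ 1 mod 4`. -/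
def quarticSign (m : ℕ) : ℤ := if m % 8 = 1 then 1 else -1

/-- A fourth root of `-1` is an element of order 8 in a cyclic group of order `m - 1`. -/
theorem MulChar.apply_neg_one_eq_quarticSign {m : ℕ} [Fact m.Prime] (hm4 : m % 4 = 1)
    {R : Type*} [CommRing R] [IsDomain R] (χ : MulChar (ZMod m) R) (hχ : orderOf χ = 4) :
    χ (-1) = (quarticSign m : R) := by
  have hm : m.Prime := Fact.out
  have h1 : (-1 : ZMod m) ≠ 0 := neg_ne_zero.mpr one_ne_zero
  have hne : (-1 : ZMod m) ≠ 1 := 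
    haveI : Fact (2 < m) := ⟨by have := hm.two_le; omega⟩
    ZMod.neg_one_ne_one
  have hiff := χ.apply_eq_one_iff_exists_pow h1
  rw [hχ] at hiff
  have hpm : χ (-1) = 1 ∨ χ (-1) = -1 := by
    rw [← sq_eq_one_iff, ← map_pow]
    simp
  have h8 : (∃ y : ZMod m, y ^ 4 = -1) ↔ m % 8 = 1 := by
    constructor
    · rintro ⟨y, hy⟩
      have ho : orderOf y = 2 ^ (2 + 1) := by
        apply orderOf_eq_prime_pow
        · simpa [hy] using hne
        · rw [pow_succ, pow_mul]; norm_num [hy]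
      have hy0 : y ≠ 0 := by rintro rfl; simp at hy
      have := orderOf_dvd_of_pow_eq_one (ZMod.pow_card_sub_one_eq_one hy0)
      rw [ho] at this
      have := hm.two_le
      omega
    · intro h
      obtain ⟨g, hg⟩ := IsCyclic.exists_generator (α := (ZMod m)ˣ)
      obtain ⟨k, hk⟩ : ∃ k, m = 8 * k + 1 := ⟨m / 8, by omega⟩
      have ho : orderOf g = 8 * k := by
        rw [orderOf_eq_card_of_forall_mem_zpowers hg, Nat.card_eq_fintype_card,
          ZMod.card_units m]
        omega
      have hk0 : 0 < k := by
        have := hm.two_le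
        omega
      have hsq : ((g ^ (4 * k) : (ZMod m)ˣ) : ZMod m) ^ 2 = 1 := by
        rw [← Units.val_pow_eq_pow_val, ← pow_mul, show 4 * k * 2 = 8 * k by ring, ← ho,
          pow_orderOf_eq_one, Units.val_one]
      rcases sq_eq_one_iff.mp hsq with h' | h'
      · exfalso
        have := orderOf_dvd_of_pow_eq_one (Units.val_eq_one.mp h')
        rw [ho] at this
        have := Nat.le_of_dvd (by omega) this
        omega
      · refine ⟨(g ^ k : (ZMod m)ˣ), ?_⟩
        rw [← Units.val_pow_eq_pow_val, ← pow_mul, mul_comm k, h']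
  rw [h8] at hiff
  unfold quarticSign
  split_ifs with h
  · simpa using hiff.mpr h
  · rcases hpm with h' | h'
    · exact absurd (hiff.mp h') h
    · simpa using h'

theorem MulChar.apply_eq_quarticSymbol {m : ℕ} [Fact m.Prime]
    {R : Type*} [CommRing R] [IsDomain R] (χ : MulChar (ZMod m) R) (hχ : orderOf χ = 4)
    {a : ℤ} (ha : (a : ZMod m) ≠ 0) (hsq : IsSquare (a : ZMod m)) :
    χ (a : ZMod m) = (quarticSymbol a m : R) := by
  have hiff := χ.apply_eq_one_iff_exists_pow ha
  rw [hχ] at hiff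
  unfold quarticSymbol
  rw [if_neg ha]
  split_ifs with h
  · simpa using hiff.mpr h
  · obtain ⟨y, hy⟩ := hsq
    have h1 : χ (a : ZMod m) ^ 2 = 1 := by
      rw [← map_pow, χ.apply_eq_one_iff_exists_pow (pow_ne_zero 2 ha), hχ]
      exact ⟨y, by rw [hy]; ring⟩
    rcases sq_eq_one_iff.mp h1 with h' | h'
    · exact absurd (hiff.mp h') h
    · simpa using h'

theorem MulChar.inv_eq_star_of_orderOf_eq_four {m : ℕ} [Fact m.Prime]
    (χ : MulChar (ZMod m) GaussianInt) (hχ : orderOf χ = 4) :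
    χ⁻¹ = χ.ringHomComp (starRingEnd GaussianInt) := by
  rw [inv_eq_iff_mul_eq_one]
  refine MulChar.ext fun u => ?_
  have h4 : χ u ^ 4 = 1 := by
    rw [← MulChar.pow_apply_coe, ← hχ, pow_orderOf_eq_one, MulChar.one_apply_coe]
  have hn : (χ u).norm = 1 := by
    have h := congrArg Zsqrtd.normMonoidHom h4
    rw [map_pow, map_one] at h
    exact (pow_eq_one_iff_of_nonneg (GaussianInt.norm_nonneg _) (by norm_num)).mp h
  have hs : χ u * star (χ u) = 1 := by
    rw [← Zsqrtd.norm_eq_mul_conj, hn, Int.cast_one]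
  rw [MulChar.mul_apply, MulChar.one_apply_coe]
  exact hs

/-- The real part is odd because `J(χ, χ) ≡ -1` modulo `(i - 1)² = -2i`. The norm is `J(χ, χ) J(χ⁻¹,
χ⁻¹) = m`, as `χ⁻¹` is the conjugate of `χ`. -/
theorem exists_quartic_mulChar {m : ℕ} [Fact m.Prime] (hm4 : m % 4 = 1) :
    ∃ χ : MulChar (ZMod m) GaussianInt, orderOf χ = 4 ∧ Odd (jacobiSum χ χ).re ∧
      (jacobiSum χ χ).re ^ 2 + (jacobiSum χ χ).im ^ 2 = m := by
  have hdvd : 4 ∣ Fintype.card (ZMod m) - 1 := by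
    rw [ZMod.card]; omega
  obtain ⟨χ, hχ⟩ := MulChar.exists_mulChar_orderOf (ZMod m) hdvd GaussianInt.isPrimitiveRoot_I
  have h4 : χ ^ 4 = 1 := hχ ▸ pow_orderOf_eq_one χ
  refine ⟨χ, hχ, ?_, ?_⟩
  · obtain ⟨z, -, hz⟩ := exists_jacobiSum_eq_neg_one_add (by norm_num) h4 h4 hdvd
      GaussianInt.isPrimitiveRoot_I
    rw [hz]
    refine ⟨z.im - 1, ?_⟩
    simp [pow_two]
    ring
  -- The product formula for Jacobi sums is read in `ℂ` and pulled back along the embedding.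
  · set f := GaussianInt.toComplex
    have hinj : Function.Injective f := GaussianInt.toComplex_injective
    have h1 : χ ≠ 1 := by
      rintro rfl
      simp at hχ
    have h2 : χ * χ ≠ 1 := by
      intro h
      have := orderOf_dvd_of_pow_eq_one ((pow_two χ).trans h)
      rw [hχ] at this
      omega
    have hchar : ringChar ℂ ≠ ringChar (ZMod m) := by
      rw [ringChar.eq_zero, ZMod.ringChar_zmod_n]
      exact (Fact.out : m.Prime).ne_zero.symm
    have h := jacobiSum_mul_jacobiSum_inv hchar
      ((MulChar.ringHomComp_ne_one_iff hinj).mpr h1) ((MulChar.ringHomComp_ne_one_iff hinj).mpr h1)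
      (by rw [← MulChar.ringHomComp_mul]; exact (MulChar.ringHomComp_ne_one_iff hinj).mpr h2)
    rw [MulChar.ringHomComp_inv, χ.inv_eq_star_of_orderOf_eq_four hχ, jacobiSum_ringHomComp,
      jacobiSum_ringHomComp, jacobiSum_ringHomComp, ← map_mul, ZMod.card, ← map_natCast f] at h
    have h' := congrArg Zsqrtd.re (hinj h)
    simp only [starRingEnd_apply, Zsqrtd.re_mul, Zsqrtd.re_star, Zsqrtd.im_star,
      Zsqrtd.re_natCast] at h'
    linarith

theorem quarticSymbol_sq {m : ℕ} {a : ℤ} (ha : (a : ZMod m) ≠ 0) : quarticSymbol a m ^ 2 = 1 := by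
  unfold quarticSymbol
  rw [if_neg ha]
  split_ifs <;> norm_num

/-! ### Quartic Gauss sums in characteristic `p`. -/

/-- Frobenius replaces `χ, ψ` by `χ ^ p, ψ ^ p`. Here `ψ ^ p` is `ψ` shifted by `p`, which costs the
factor `χ ^ p` at `p`; this is `q`, since `q² = 1` and `p` is odd. -/
theorem gaussSum_pow_char_eq_mul {F R : Type*} [Field F] [Fintype F] [CommRing R]
    {p : ℕ} [Fact p.Prime] [CharP R p] (hp2 : p ≠ 2) (hp : (p : F) ≠ 0)
    (χ : MulChar F R) (ψ : AddChar F R) {q : R} (hq : χ (p : F) = q) (hq2 : q ^ 2 = 1) :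
    gaussSum χ ψ ^ p = q * gaussSum (χ ^ p) ψ := by
  obtain ⟨k, hk⟩ := (Fact.out : p.Prime).odd_of_ne_two hp2
  have hqp : (χ ^ p) (p : F) = q := by
    rw [MulChar.pow_apply' χ (Fact.out : p.Prime).ne_zero, hq]
    conv_lhs => rw [hk]
    rw [pow_succ, pow_mul, hq2, one_pow, one_mul]
  have h := gaussSum_mulShift (χ ^ p) ψ (Units.mk0 _ hp)
  rw [Units.val_mk0, hqp, ← AddChar.pow_mulShift, ← gaussSum_frob p] at h
  rw [← h, ← mul_assoc, ← sq, hq2, one_mul]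

/-- The quartic Gauss sums `g = g(χ)` and `g' = g(χ⁻¹)` in characteristic `p`, with
`J(χ, χ) = a + b i`, and with the sign of `g(χ²)` prescribed. -/
theorem exists_quartic_gaussSums {m : ℕ} [Fact m.Prime] (hm4 : m % 4 = 1)
    {p : ℕ} [Fact p.Prime] (hp2 : p ≠ 2) (hpm : (p : ZMod m) ≠ 0) (hsq : IsSquare (p : ZMod m))
    {F : Type*} [Field F] [IsAlgClosed F] [CharP F p]
    {s : F} (hs : s ^ 2 = m) :
    ∃ (a b : ℤ) (i g g' : F), Odd a ∧ a ^ 2 + b ^ 2 = m ∧ i ^ 2 = -1 ∧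
      g ^ 2 = (a + b * i) * s ∧ g' ^ 2 = (a - b * i) * s ∧ g * g' = quarticSign m * m ∧
      ((g ^ p = quarticSymbol p m * g ∧ g' ^ p = quarticSymbol p m * g' ∧ i ^ p = i) ∨
       (g ^ p = quarticSymbol p m * g' ∧ g' ^ p = quarticSymbol p m * g ∧ i ^ p = -i)) := by
  have hp : p.Prime := Fact.out
  have h2 : (-1 : F) ≠ 1 := by
    exact Ring.neg_one_ne_one_of_char_ne_two (by rwa [ringChar.eq F p])
  obtain ⟨i, hi⟩ := IsAlgClosed.exists_pow_nat_eq (-1 : F) (n := 2) (by norm_num)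
  obtain ⟨χ₀, hχ₀, hodd, hnorm⟩ := exists_quartic_mulChar hm4
  set a := (jacobiSum χ₀ χ₀).re with ha
  set b := (jacobiSum χ₀ χ₀).im with hb
  set φ : GaussianInt →+* F := Zsqrtd.lift ⟨i, by rw [← sq, hi]; simp⟩ with hφ
  set χ := χ₀.ringHomComp φ with hχ
  have h4 : χ ^ 4 = 1 := by
    rw [hχ, MulChar.ringHomComp_pow, ← hχ₀, pow_orderOf_eq_one, MulChar.ringHomComp_one]
  have hne2 : χ * χ ≠ 1 := by
    intro h
    have hne : χ₀ ^ 2 ≠ 1 := fun h' => by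
      have := orderOf_dvd_of_pow_eq_one h'
      rw [hχ₀] at this
      omega
    obtain ⟨u, hu⟩ := MulChar.ne_one_iff.mp hne
    have hu4 : ((χ₀ ^ 2) u) ^ 2 = 1 := by
      rw [MulChar.pow_apply_coe, ← pow_mul, ← MulChar.pow_apply_coe]
      rw [show 2 * 2 = orderOf χ₀ from hχ₀.symm, pow_orderOf_eq_one, MulChar.one_apply_coe]
    have hum := (sq_eq_one_iff.mp hu4).resolve_left hu
    have h' : (χ * χ) u = 1 := by rw [h, MulChar.one_apply_coe]
    rw [← sq, hχ, MulChar.ringHomComp_pow, MulChar.ringHomComp_apply, hum, map_neg, map_one] at h'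
    exact h2 h'
  have hne1 : χ ≠ 1 := fun h => hne2 (by rw [h, one_mul])
  have hord : orderOf χ = 4 := by
    have := orderOf_eq_prime_pow (p := 2) (n := 1) (x := χ) (by simpa [sq] using hne2)
      (by simpa using h4)
    simpa using this
  have hinv : χ⁻¹ = χ ^ 3 := by
    rw [inv_eq_iff_mul_eq_one, ← pow_succ', h4]
  have hordinv : orderOf χ⁻¹ = 4 := by rw [orderOf_inv, hord]
  have hmF : (m : F) ≠ 0 := by
    intro h
    rw [CharP.cast_eq_zero_iff F p] at h
    have := (Nat.prime_dvd_prime_iff_eq hp Fact.out).mp h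
    subst this
    simp at hpm
  have : NeZero (m : F) := ⟨hmF⟩
  obtain ⟨ζ, hζ⟩ := HasEnoughRootsOfUnity.exists_primitiveRoot F m
  set ψ := AddChar.zmodChar m ((IsPrimitiveRoot.iff_def ζ m).mp hζ).left
  have hψ : ψ.IsPrimitive := AddChar.zmodChar_primitive_of_primitive_root m hζ
  have hJ : jacobiSum χ χ = a + b * i := by
    rw [hχ, jacobiSum_ringHomComp, hφ, Zsqrtd.lift_apply_apply]
  have hJ' : jacobiSum χ⁻¹ χ⁻¹ = a - b * i := by
    rw [hχ, MulChar.ringHomComp_inv, χ₀.inv_eq_star_of_orderOf_eq_four hχ₀, jacobiSum_ringHomComp,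
      jacobiSum_ringHomComp, hφ, Zsqrtd.lift_apply_apply]
    simp [starRingEnd_apply, a, b, sub_eq_add_neg]
  have hsqinv : χ⁻¹ * χ⁻¹ = χ * χ := by
    rw [hinv, ← pow_add, ← sq, show 3 + 3 = 4 + 2 from rfl, pow_add, h4, one_mul]
  have hquad : (χ * χ).IsQuadratic := by
    rw [MulChar.isQuadratic_iff_sq_eq_one, ← sq, ← pow_mul, h4]
  set g := gaussSum χ ψ
  set g' := gaussSum χ⁻¹ ψ
  set S := gaussSum (χ * χ) ψ
  have hg : g ^ 2 = (a + b * i) * S := by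
    rw [← hJ, mul_comm, jacobiSum_mul_nontrivial hne2, sq]
  have hg' : g' ^ 2 = (a - b * i) * S := by
    have h := jacobiSum_mul_nontrivial (χ := χ⁻¹) (φ := χ⁻¹) (by rwa [hsqinv]) ψ
    rw [← hJ', sq, ← h, hsqinv, mul_comm]
  have hneg := χ.apply_neg_one_eq_quarticSign hm4 hord
  have hS : S ^ 2 = m := by
    rw [gaussSum_sq hne2 hquad hψ, ZMod.card, MulChar.mul_apply, ← map_mul]
    simp
  have hgg : g * g' = quarticSign m * m := by
    have h := gaussSum_mul_gaussSum_pow_orderOf_sub_one hne1 hψ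
    rwa [hord, show 4 - 1 = 3 from rfl, ← hinv, hneg, ZMod.card] at h
  have hq2 : (quarticSymbol p m : F) ^ 2 = 1 := by
    rw [← Int.cast_pow, quarticSymbol_sq (by simpa using hpm), Int.cast_one]
  have hq : χ (p : ZMod m) = quarticSymbol p m := by
    simpa using χ.apply_eq_quarticSymbol hord (a := p) (by simpa using hpm) (by simpa using hsq)
  have hq' : χ⁻¹ (p : ZMod m) = quarticSymbol p m := by
    simpa using χ⁻¹.apply_eq_quarticSymbol hordinv (a := p) (by simpa using hpm)
      (by simpa using hsq)
  have hf := gaussSum_pow_char_eq_mul hp2 hpm χ ψ hq hq2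
  have hf' := gaussSum_pow_char_eq_mul hp2 hpm χ⁻¹ ψ hq' hq2
  have hi4 : i ^ 4 = 1 := by rw [show 4 = 2 * 2 from rfl, pow_mul, hi]; norm_num
  have hfrob : (g ^ p = quarticSymbol p m * g ∧ g' ^ p = quarticSymbol p m * g' ∧ i ^ p = i) ∨
      (g ^ p = quarticSymbol p m * g' ∧ g' ^ p = quarticSymbol p m * g ∧ i ^ p = -i) := by
    have hcases : p = 4 * (p / 4) + 1 ∨ p = 4 * (p / 4) + 3 := by
      obtain ⟨k, hk⟩ := hp.odd_of_ne_two hp2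
      omega
    rcases hcases with hk | hk
    · left
      have h1 : χ ^ p = χ := by rw [hk, pow_succ, pow_mul, h4, one_pow, one_mul]
      rw [inv_pow, h1] at hf'
      rw [h1] at hf
      refine ⟨hf, hf', ?_⟩
      rw [hk, pow_succ, pow_mul, hi4, one_pow, one_mul]
    · right
      have h3 : χ ^ p = χ⁻¹ := by rw [hk, pow_add, pow_mul, h4, one_pow, one_mul, hinv]
      rw [inv_pow, h3, inv_inv] at hf'
      rw [h3] at hf
      refine ⟨hf, hf', ?_⟩
      rw [hk, pow_add, pow_mul, hi4, one_pow, one_mul, pow_succ, hi, neg_one_mul]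
  -- The sign of the quadratic Gauss sum is never determined: it is absorbed into `(a, b)`.
  have hSs : S = s ∨ S = -s := sq_eq_sq_iff_eq_or_eq_neg.mp (hS.trans hs.symm)
  rcases hSs with h | h
  · rw [h] at hg hg'
    exact ⟨a, b, i, g, g', hodd, hnorm, hi, hg, hg', hgg, hfrob⟩
  · rw [h] at hg hg'
    refine ⟨-a, -b, i, g, g', hodd.neg, by rw [neg_sq, neg_sq, hnorm], hi, ?_, ?_, hgg, hfrob⟩
    · rw [hg]; push_cast; ring
    · rw [hg']; push_cast; ring

/-- For `p ≡ 3 mod 4` Frobenius swaps `g` and `g'` up to the sign `q`, and sends `i` to `-i`. So `(g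
+ g')/2` and `(g - g')/(2i)` are eigenvectors for `q` whatever `p` is mod 4; `γ` and `δ` are their
sum and difference. -/
theorem exists_quartic_radicals {m : ℕ} [Fact m.Prime] (hm4 : m % 4 = 1)
    {p : ℕ} [Fact p.Prime] (hp2 : p ≠ 2) (hpm : (p : ZMod m) ≠ 0) (hsq : IsSquare (p : ZMod m))
    {F : Type*} [Field F] [IsAlgClosed F] [CharP F p]
    {s : F} (hs : s ^ 2 = m) :
    ∃ (a b : ℤ) (γ δ : F), Odd a ∧ a ^ 2 + b ^ 2 = m ∧
      γ ^ p = quarticSymbol p m * γ ∧ δ ^ p = quarticSymbol p m * δ ∧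
      γ ^ 2 = quarticSign m * m + b * s ∧ δ ^ 2 = quarticSign m * m - b * s ∧
      γ * δ = a * s := by
  obtain ⟨a, b, i, g, g', hodd, hnorm, hi, hg, hg', hgg, hfrob⟩ :=
    exists_quartic_gaussSums hm4 hp2 hpm hsq hs
  have h2 : (2 : F) ≠ 0 := Ring.two_ne_zero (by rwa [ringChar.eq F p])
  have h2p : (2 : F) ^ p = 2 := by
    have := map_ofNat (frobenius F p) 2
    rwa [frobenius_def] at this
  have hi0 : i ≠ 0 := by
    rintro rfl
    norm_num at hi
  set α := (g + g') / 2 with hα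
  set β := (g - g') / (2 * i) with hβ
  have hαp : α ^ p = quarticSymbol p m * α := by
    rw [hα, div_pow, add_pow_char, h2p]
    rcases hfrob with ⟨h, h', -⟩ | ⟨h, h', -⟩ <;> rw [h, h'] <;> ring
  have hβp : β ^ p = quarticSymbol p m * β := by
    rw [hβ, div_pow, sub_pow_char, mul_pow, h2p]
    rcases hfrob with ⟨h, h', h''⟩ | ⟨h, h', h''⟩ <;> rw [h, h', h''] <;> field_simp
    ring
  have hα2 : 2 * α ^ 2 = quarticSign m * m + a * s := by
    rw [hα]; field_simp
    linear_combination hg + hg' + 2 * hgg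
  have hβ2 : 2 * β ^ 2 = quarticSign m * m - a * s := by
    rw [hβ]; field_simp
    linear_combination hg + hg' - 2 * hgg - 2 * (quarticSign m * m - a * s) * hi
  have hαβ : 2 * (α * β) = b * s := by
    rw [hα, hβ]; field_simp
    linear_combination hg - hg'
  refine ⟨a, b, α + β, α - β, hodd, hnorm, ?_, ?_, ?_, ?_, ?_⟩
  · rw [add_pow_char, hαp, hβp, mul_add]
  · rw [sub_pow_char, hαp, hβp, mul_sub]
  · apply mul_left_cancel₀ h2
    linear_combination hα2 + hβ2 + 2 * hαβ
  · apply mul_left_cancel₀ h2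
    linear_combination hα2 + hβ2 - 2 * hαβ
  · apply mul_left_cancel₀ h2
    linear_combination hα2 - hβ2

/-! ### Primitive solutions of `m D² = B² + C²`, and the square root of `A + B s`. -/

/-- A primitive solution of `m D² = B² + C²` arises from a representation `m = a² + b²` by
multiplying with the square of a Gaussian integer. -/
theorem exists_sq_add_sq_of_mul_sq_eq {m : ℕ} (hm : m.Prime) {a b B C D : ℤ}
    (hab : a ^ 2 + b ^ 2 = m) (ha : Odd a) (hb : Even b) (hB : Even B) (hBC : IsCoprime B C)
    (h : m * D ^ 2 = B ^ 2 + C ^ 2) (hD : 0 < D) :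
    ∃ r t : ℤ, D = r ^ 2 + t ^ 2 ∧ B = b * (r ^ 2 - t ^ 2) + 2 * a * r * t ∧
      Odd (r ^ 2 - t ^ 2) ∧ Even (r * t) := by
  have hmZ : Prime (m : ℤ) := Nat.prime_iff_prime_int.mp hm
  have hm0 : (m : ℤ) ≠ 0 := hmZ.ne_zero
  -- `C` is absent from the conclusion, so its sign may be chosen to make `C + B i` divisible by `a
  -- + b i`. The quotient `X + Y i` then has norm `D²`.
  wlog hdvd : (m : ℤ) ∣ a * B - b * C generalizing C
  · have hprod : (m : ℤ) ∣ (a * B - b * C) * (a * B - b * (-C)) :=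
      ⟨B ^ 2 - b ^ 2 * D ^ 2, by linear_combination B ^ 2 * hab + b ^ 2 * h⟩
    exact this (C := -C) hBC.neg_right (by rw [neg_sq, h])
      ((hmZ.dvd_or_dvd hprod).resolve_left hdvd)
  obtain ⟨Y, hY⟩ := hdvd
  have hdvd' : (m : ℤ) ∣ a * C + b * B := by
    apply hmZ.dvd_of_dvd_pow (n := 2)
    refine ⟨m * D ^ 2 - m * Y ^ 2, ?_⟩
    linear_combination (B ^ 2 + C ^ 2) * hab - m * h - (a * B - b * C + m * Y) * hY
  obtain ⟨X, hX⟩ := hdvd'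
  have hBXY : B = b * X + a * Y := by
    apply mul_left_cancel₀ hm0
    linear_combination -B * hab + b * hX + a * hY
  have hCXY : C = a * X - b * Y := by
    apply mul_left_cancel₀ hm0
    linear_combination -C * hab + a * hX - b * hY
  have hXY : X * X + Y * Y = D * D := by
    apply mul_left_cancel₀ hm0
    rw [hBXY, hCXY] at h
    linear_combination -(X ^ 2 + Y ^ 2) * hab - h
  have hcop : IsCoprime X Y := by
    obtain ⟨u, v, huv⟩ := hBC
    exact ⟨u * b + v * a, u * a - v * b, by
      rw [← huv, hBXY, hCXY]; ring⟩
  have hYe : Even Y := by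
    have h1 : Even (a * Y) := by
      rw [show a * Y = B - b * X by rw [hBXY]; ring]
      exact hB.sub (hb.mul_right X)
    exact (Int.even_mul.mp h1).resolve_left (Int.not_even_iff_odd.mpr ha)
  have hXo : X % 2 = 1 := by
    rw [← Int.odd_iff, ← Int.not_even_iff_odd]
    intro hXe
    have := hcop.isUnit_of_dvd' hXe.two_dvd hYe.two_dvd
    rw [Int.isUnit_iff] at this
    omega
  obtain ⟨r, t, hr, ht, hrt, -, hpar, -⟩ :=
    PythagoreanTriple.coprime_classification' hXY (Int.isCoprime_iff_gcd_eq_one.mp hcop) hXo hD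
  refine ⟨r, t, hrt, ?_, ?_, ?_⟩
  · rw [hBXY, hr, ht]; ring
  · rw [← hr, Int.odd_iff, hXo]
  · rw [Int.even_mul, Int.even_iff, Int.even_iff]
    omega

/-- The Legendre symbol of a number whose square root `ω` satisfies `ω ^ p = q ω`. -/
theorem legendreSym_eq_of_pow_eq {p : ℕ} [Fact p.Prime] (hp2 : p ≠ 2) {F : Type*} [Field F]
    [CharP F p] {n q : ℤ} (hn : ¬ (p : ℤ) ∣ n) (hq : q ^ 2 = 1) {ω : F} (hω : ω ^ 2 = n)
    (hωp : ω ^ p = q * ω) : legendreSym p n = q := by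
  have hnF : (n : F) ≠ 0 := by rwa [Ne, CharP.intCast_eq_zero_iff F p]
  have hω0 : ω ≠ 0 := by
    rintro rfl
    exact hnF (by rw [← hω]; ring)
  obtain ⟨k, hk⟩ := (Fact.out : p.Prime).odd_of_ne_two hp2
  have h1 : (n : F) ^ (p / 2) = q := by
    apply mul_right_cancel₀ hω0
    rw [← hωp, ← hω, ← pow_mul, ← pow_succ]
    congr 1
    omega
  have h2 : ((legendreSym p n : ℤ) : F) = (n : F) ^ (p / 2) := by
    have := congrArg (ZMod.castHom (dvd_refl p) F) (legendreSym.eq_pow p n)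
    simpa using this
  rw [h1] at h2
  have hF2 : (-1 : F) ≠ 1 := Ring.neg_one_ne_one_of_char_ne_two (by rwa [ringChar.eq F p])
  have hn' : ((n : ℤ) : ZMod p) ≠ 0 := by rwa [Ne, ZMod.intCast_zmod_eq_zero_iff_dvd]
  rcases legendreSym.eq_one_or_neg_one p hn' with h | h <;>
    rcases sq_eq_one_iff.mp hq with h' | h' <;> rw [h, h'] at h2 ⊢
  · exact absurd (by simpa using h2.symm) hF2
  · exact absurd (by simpa using h2) hF2

theorem not_dvd_add_mul_of_not_dvd {m : ℕ} {A B C : ℤ} (hABC : A ^ 2 = (m : ℤ) * (B ^ 2 + C ^ 2))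
    {p : ℕ} [Fact p.Prime] (hpm : ¬ (p : ℤ) ∣ m) (hpC : ¬ (p : ℤ) ∣ C)
    {s : ℤ} (hs : s ^ 2 ≡ m [ZMOD p]) : ¬ (p : ℤ) ∣ A + B * s := by
  have hp : Prime (p : ℤ) := Nat.prime_iff_prime_int.mp Fact.out
  intro h
  have h1 : (p : ℤ) ∣ m * C ^ 2 := by
    rw [show (m : ℤ) * C ^ 2 = (A + B * s) * (A - B * s) - B ^ 2 * (m - s ^ 2) by
      linear_combination -hABC]
    exact dvd_sub (h.mul_right _) (hs.dvd.mul_left _)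
  exact (hp.dvd_or_dvd h1).elim hpm fun h => hpC (hp.dvd_of_dvd_pow h)

/-- Modulo 4, `|D| ≡ 1` and `B ≡ b`, so `D ≡ 1 - b`. As `a² ≡ 1 mod 8`, the condition `4 ∣ b` is
equivalent to `m ≡ 1 mod 8`. -/
theorem eq_quarticSign_mul_of_modEq {m : ℕ} {a b r t B D : ℤ} (hm4 : m % 4 = 1)
    (hab : a ^ 2 + b ^ 2 = m) (ha : Odd a) (hb : Even b) (hD : |D| = r ^ 2 + t ^ 2)
    (hB : B = b * (r ^ 2 - t ^ 2) + 2 * a * r * t) (hodd : Odd (r ^ 2 - t ^ 2))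
    (heven : Even (r * t)) (h4 : m * D + B ≡ 1 [ZMOD 4]) :
    D = quarticSign m * (r ^ 2 + t ^ 2) := by
  obtain ⟨b', rfl⟩ := hb.two_dvd
  obtain ⟨k, hk⟩ := heven.two_dvd
  obtain ⟨l, hl⟩ := hodd
  have hB4 : B % 4 = (2 * b') % 4 := by
    rw [hl, show 2 * a * r * t = 2 * a * (r * t) by ring, hk] at hB
    rw [hB, show 2 * b' * (2 * l + 1) + 2 * a * (2 * k) = 2 * b' + 4 * (b' * l + a * k) by ring,
      Int.add_mul_emod_self_left]
  have hD4 : |D| % 4 = 1 := by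
    rcases Int.even_or_odd' r with ⟨u, rfl | rfl⟩ <;>
      rcases Int.even_or_odd' t with ⟨v, rfl | rfl⟩ <;>
      ring_nf at hl hD hk <;> omega
  have hmD : (m * D + B) % 4 = (D + B) % 4 := by
    obtain ⟨n, hn⟩ : ∃ n : ℤ, (m : ℤ) = 4 * n + 1 := ⟨m / 4, by omega⟩
    rw [hn, show (4 * n + 1) * D + B = D + B + 4 * (n * D) by ring, Int.add_mul_emod_self_left]
  have h1 : (D + B) % 4 = 1 := by
    rw [← hmD]
    exact h4
  have ha8 : a ^ 2 % 8 = 1 := by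
    have h : a % 8 = 1 ∨ a % 8 = 3 ∨ a % 8 = 5 ∨ a % 8 = 7 := by
      have := Int.odd_iff.mp ha
      omega
    rw [sq, Int.mul_emod]
    rcases h with h | h | h | h <;> rw [h] <;> norm_num
  have hm8 : m % 8 = 1 ↔ b' % 2 = 0 := by
    rcases Int.even_or_odd' b' with ⟨u, rfl | rfl⟩ <;> ring_nf at hab <;> omega
  rw [← hD]
  unfold quarticSign
  split_ifs with h8
  · rw [hm8] at h8
    rcases abs_choice D with h | h <;> rw [h] at hD4 ⊢ <;> omega
  · rw [hm8] at h8
    rcases abs_choice D with h | h <;> rw [h] at hD4 ⊢ <;> omega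

theorem legendreSym_add_mul_eq_quarticSymbol (F : Type*) [Field F] [IsAlgClosed F]
    {m : ℕ} [hm : Fact m.Prime] (hm4 : m % 4 = 1)
    {A B C : ℤ} (hABC : A ^ 2 = (m : ℤ) * (B ^ 2 + C ^ 2)) (hB : 2 ∣ B) (hBC : IsCoprime B C)
    (hAB4 : A + B ≡ 1 [ZMOD 4]) {p : ℕ} [Fact p.Prime] [CharP F p] (hp2 : p ≠ 2)
    (hmp : legendreSym p (m : ℤ) = 1) {s : ℤ} (hs : s ^ 2 ≡ m [ZMOD p])
    (hns : ¬ (p : ℤ) ∣ A + B * s) : legendreSym p (A + B * s) = quarticSymbol p m := by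
  have hmZ : Prime (m : ℤ) := Nat.prime_iff_prime_int.mp hm.out
  have hpne : p ≠ m := by
    rintro rfl
    rw [(legendreSym.eq_zero_iff p _).mpr (by simp)] at hmp
    exact zero_ne_one hmp
  have hpm : (p : ZMod m) ≠ 0 := by
    rw [Ne, ZMod.natCast_eq_zero_iff, Nat.prime_dvd_prime_iff_eq hm.out Fact.out]
    exact hpne.symm
  have hsq : IsSquare (p : ZMod m) := by
    have h := hmp
    -- Reciprocity makes `p` a square mod `m`, so a quartic character takes the value `±1` at `p`.
    rw [legendreSym.quadratic_reciprocity_one_mod_four hm4 hp2] at h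
    have := (legendreSym.eq_one_iff m (a := p) (by simpa using hpm)).mp h
    simpa using this
  have hsF : (s : F) ^ 2 = m := by
    have := (CharP.intCast_eq_intCast F p).mpr hs
    simpa using this
  obtain ⟨a, b, γ, δ, ha, hab, hγp, hδp, hγ, hδ, hγδ⟩ :=
    exists_quartic_radicals hm4 hp2 hpm hsq hsF
  obtain ⟨D, hD⟩ : (m : ℤ) ∣ A := hmZ.dvd_of_dvd_pow (n := 2) ⟨_, hABC⟩
  have hmD : (m : ℤ) * D ^ 2 = B ^ 2 + C ^ 2 := by
    apply mul_left_cancel₀ hmZ.ne_zero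
    rw [← hABC, hD]; ring
  have hb : Even b := by
    have h1 : Odd (a ^ 2 + b ^ 2) := by
      rw [hab, Int.odd_iff]; omega
    have h2 := (Int.odd_add.mp h1).mp ha.pow
    exact (Int.even_pow.mp h2).1
  have hD0 : D ≠ 0 := by
    rintro rfl
    have hB0 : B = 0 := by nlinarith [sq_nonneg B, sq_nonneg C]
    have hC0 : C = 0 := by nlinarith [sq_nonneg B, sq_nonneg C]
    rw [hB0, hC0] at hBC
    exact not_isCoprime_zero_zero hBC
  obtain ⟨r, t, hrt, hBrt, hodd, heven⟩ := exists_sq_add_sq_of_mul_sq_eq hm.out hab ha hb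
    (even_iff_two_dvd.mpr hB) hBC (D := |D|) (by rw [sq_abs, hmD]) (abs_pos.mpr hD0)
  have hsign := eq_quarticSign_mul_of_modEq hm4 hab ha hb hrt hBrt hodd heven (hD ▸ hAB4)
  have hω : ((r : F) * γ + t * δ) ^ 2 = ((A + B * s : ℤ) : F) := by
    have hDF : (D : F) = quarticSign m * (r ^ 2 + t ^ 2) := by
      exact_mod_cast congrArg (Int.cast : ℤ → F) hsign
    have hBF : (B : F) = b * (r ^ 2 - t ^ 2) + 2 * a * r * t := by
      exact_mod_cast congrArg (Int.cast : ℤ → F) hBrt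
    rw [hD]
    push_cast
    rw [hDF, hBF]
    linear_combination r ^ 2 * hγ + t ^ 2 * hδ + 2 * r * t * hγδ
  have hfix : ∀ n : ℤ, (n : F) ^ p = n := fun n => by
    have := map_intCast (frobenius F p) n
    rwa [frobenius_def] at this
  refine legendreSym_eq_of_pow_eq hp2 hns (quarticSymbol_sq (by simpa using hpm)) hω ?_
  rw [add_pow_char, mul_pow, mul_pow, hγp, hδp, hfix, hfix]
  ring

/-! ### The quadratic symbol depends only on the square class. -/

theorem SameSquareClass.symm {R : Type*} [CommRing R] {α β : R} (h : SameSquareClass α β) :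
    SameSquareClass β α := by
  obtain ⟨γ, δ, hγ, hδ, h⟩ := h
  exact ⟨δ, γ, hδ, hγ, h.symm⟩

theorem SameSquareClass.trans {R : Type*} [CommRing R] [IsDomain R] {α β ε : R}
    (h : SameSquareClass α β) (h' : SameSquareClass β ε) : SameSquareClass α ε := by
  obtain ⟨γ, δ, hγ, hδ, h⟩ := h
  obtain ⟨γ', δ', hγ', hδ', h'⟩ := h'
  refine ⟨γ * γ', δ * δ', mul_ne_zero hγ hγ', mul_ne_zero hδ hδ', ?_⟩
  linear_combination γ' ^ 2 * h + δ ^ 2 * h'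

theorem quadraticSymbol_congr {R : Type*} [CommRing R] [IsDomain R] (P : Ideal R) {α β : R}
    (h : SameSquareClass α β) : quadraticSymbol P α = quadraticSymbol P β := by
  have heq : SameSquareClass α = SameSquareClass β :=
    funext fun ε => propext ⟨h.symm.trans, h.trans⟩
  unfold quadraticSymbol
  rw [heq]

/-- The localization at `P` is a valuation ring, so one of `γ/δ`, `δ/γ` has a denominator prime to
`P`. -/
theorem exists_mul_eq_mul_of_isPrime {R : Type*} [CommRing R] [IsDedekindDomain R] (P : Ideal R)
    [P.IsPrime] (hP : P ≠ ⊥) (γ δ : R) :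
    (∃ x, ∃ y ∉ P, γ * y = δ * x) ∨ ∃ x, ∃ y ∉ P, δ * y = γ * x := by
  have := IsLocalization.AtPrime.isDiscreteValuationRing_of_dedekind_domain R hP
    (Localization.AtPrime P)
  have key : ∀ γ δ : R, algebraMap R (Localization.AtPrime P) δ ∣
      algebraMap R (Localization.AtPrime P) γ → ∃ x, ∃ y ∉ P, γ * y = δ * x := by
    rintro γ δ ⟨c, hc⟩
    obtain ⟨⟨x, y⟩, hxy⟩ := IsLocalization.surj P.primeCompl c
    refine ⟨x, y, y.2, ?_⟩
    apply IsLocalization.injective (Localization.AtPrime P) P.primeCompl_le_nonZeroDivisors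
    rw [map_mul, map_mul, ← hxy, hc, mul_assoc]
  rcases ValuationRing.dvd_total (algebraMap R (Localization.AtPrime P) δ)
    (algebraMap R (Localization.AtPrime P) γ) with h | h
  · exact .inl (key γ δ h)
  · exact .inr (key δ γ h)

theorem SameSquareClass.isSquare_mk {R : Type*} [CommRing R] [IsDedekindDomain R] {P : Ideal R}
    [hPp : P.IsPrime] (hP : P ≠ ⊥) {α β : R} (hα : α ∉ P) (h : SameSquareClass α β)
    (hsq : IsSquare (Ideal.Quotient.mk P α)) : IsSquare (Ideal.Quotient.mk P β) := by
  have : P.IsMaximal := hPp.isMaximal hP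
  let _ := Ideal.Quotient.field P
  obtain ⟨γ, δ, hγ, hδ, h⟩ := h
  have key : ∀ x y : R, y ∉ P → β * y ^ 2 = α * x ^ 2 → IsSquare (Ideal.Quotient.mk P β) := by
    intro x y hy h
    obtain ⟨c, hc⟩ := hsq
    have hy' : Ideal.Quotient.mk P y ≠ 0 := by rwa [Ne, Ideal.Quotient.eq_zero_iff_mem]
    refine ⟨c * Ideal.Quotient.mk P x / Ideal.Quotient.mk P y, ?_⟩
    have h' := congrArg (Ideal.Quotient.mk P) h
    simp only [map_mul, map_pow] at h'
    field_simp
    rw [h', hc]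
    ring
  rcases exists_mul_eq_mul_of_isPrime P hP γ δ with ⟨x, y, hy, hxy⟩ | ⟨x, y, hy, hxy⟩
  · refine key x y hy ?_
    apply mul_left_cancel₀ (pow_ne_zero 2 hδ)
    linear_combination -y ^ 2 * h + α * (γ * y + δ * x) * hxy
  · have h2 : β * x ^ 2 = α * y ^ 2 := by
      apply mul_left_cancel₀ (pow_ne_zero 2 hγ)
      linear_combination -y ^ 2 * h - β * (δ * y + γ * x) * hxy
    -- The ratio is a unit at `P`: `x ∈ P` would put `α y²` in `P`, although neither `α` nor `y`
    -- lies there.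
    refine key y x (fun hx => ?_) h2
    have h3 : α * y ^ 2 ∈ P := h2 ▸ P.mul_mem_left _ (Ideal.pow_mem_of_mem P hx 2 (by norm_num))
    exact (hPp.mem_or_mem h3).elim hα fun h => hy (hPp.mem_of_pow_mem 2 h)

open Classical in
theorem quadraticSymbol_of_notMem {R : Type*} [CommRing R] [IsDedekindDomain R] {P : Ideal R}
    [P.IsPrime] (hP : P ≠ ⊥) {α : R} (hα : α ∉ P) :
    quadraticSymbol P α = if IsSquare (Ideal.Quotient.mk P α) then 1 else -1 := by
  have hrefl : SameSquareClass α α := ⟨1, 1, one_ne_zero, one_ne_zero, rfl⟩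
  have hiff : (∃ β, SameSquareClass α β ∧ β ∉ P ∧ IsSquare (Ideal.Quotient.mk P β)) ↔
      IsSquare (Ideal.Quotient.mk P α) :=
    ⟨fun ⟨_, h, hβ, hsq⟩ => h.symm.isSquare_mk hP hβ hsq, fun h => ⟨α, hrefl, hα, h⟩⟩
  unfold quadraticSymbol
  rw [if_pos (⟨α, hrefl, hα⟩ : ∃ β, SameSquareClass α β ∧ β ∉ P)]
  simp only [hiff]

/-! ### Prime ideals of degree one. -/

theorem Ideal.intCast_mem_iff_dvd {R : Type*} [CommRing R] {P : Ideal R} [hP : P.IsPrime]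
    {p : ℕ} [Fact p.Prime] (hp : (p : R) ∈ P) (n : ℤ) : (n : R) ∈ P ↔ (p : ℤ) ∣ n := by
  constructor
  · intro hn
    by_contra h
    have hpZ : Prime (p : ℤ) := Nat.prime_iff_prime_int.mp Fact.out
    obtain ⟨u, v, huv⟩ := hpZ.coprime_iff_not_dvd.mpr h
    apply hP.ne_top
    rw [P.eq_top_iff_one]
    have : (1 : R) = u * p + v * n := by exact_mod_cast congrArg (Int.cast : ℤ → R) huv.symm
    rw [this]
    exact P.add_mem (P.mul_mem_left _ hp) (P.mul_mem_left _ hn)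
  · rintro ⟨c, rfl⟩
    rw [Int.cast_mul]
    exact P.mul_mem_right _ (by exact_mod_cast hp)

theorem Ideal.exists_intCast_sub_mem_of_sq_eq {R : Type*} [CommRing R] {P : Ideal R}
    [hP : P.IsPrime] {p : ℕ} (hp : (p : R) ∈ P) {m : ℤ} {w : R} (hw : w ^ 2 = m)
    {s : ℤ} (hs : s ^ 2 ≡ m [ZMOD p]) : ∃ s' : ℤ, s' ^ 2 = s ^ 2 ∧ w - s' ∈ P := by
  have h : (w - s) * (w + s) ∈ P := by
    obtain ⟨c, hc⟩ := hs.dvd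
    have hc' : (m : R) - s ^ 2 = p * c := by exact_mod_cast congrArg (Int.cast : ℤ → R) hc
    rw [show (w - s) * (w + s) = p * c by linear_combination hw + hc']
    exact P.mul_mem_right _ hp
  rcases hP.mem_or_mem h with h | h
  · exact ⟨s, rfl, h⟩
  · exact ⟨-s, neg_sq s, by simpa using h⟩

open NumberField in
/-- In a quadratic field `ℚ(w)` with `w² = m`, twice an algebraic integer times `w` lies in
`ℤ + ℤ w`. -/
theorem exists_two_mul_mul_eq {m : ℕ} (hm : m.Prime) {k : Type*} [Field k] [NumberField k]
    (hk : Module.finrank ℚ k = 2) {w : 𝓞 k} (hw : w ^ 2 = (m : 𝓞 k)) (x : 𝓞 k) :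
    ∃ t e : ℤ, 2 * x * w = t * w + e := by
  have hwk : (w : k) ^ 2 = m := by exact_mod_cast congrArg (algebraMap (𝓞 k) k) hw
  have hnr : ∀ q : ℚ, algebraMap ℚ k q ≠ w := by
    intro q hq
    have h1 : q ^ 2 = m := by
      apply (algebraMap ℚ k).injective
      rw [map_pow, hq, hwk, map_natCast]
    have h2 : IsSquare (m : ℚ) := ⟨q, by rw [← h1, sq]⟩
    rw [Rat.isSquare_natCast_iff] at h2
    exact hm.prime.not_isSquare h2
  have hli : LinearIndependent ℚ ![(1 : k), w] := by
    rw [LinearIndependent.pair_iff]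
    intro u v huv
    have hv : v = 0 := by
      by_contra hv
      apply hnr (-u / v)
      rw [map_div₀, map_neg, div_eq_iff (by simpa using hv)]
      rw [Algebra.smul_def, Algebra.smul_def] at huv
      linear_combination -huv
    refine ⟨?_, hv⟩
    rw [hv] at huv
    simpa using huv
  have hspan := hli.span_eq_top_of_card_eq_finrank (by simp [hk])
  have hdec : ∀ y : k, ∃ u v : ℚ, y = algebraMap ℚ k u + algebraMap ℚ k v * w := by
    intro y
    have hy : y ∈ Submodule.span ℚ (Set.range ![(1 : k), w]) := hspan ▸ Submodule.mem_top
    rw [Matrix.range_cons, Matrix.range_cons, Matrix.range_empty, Set.union_empty,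
      Set.singleton_union, Submodule.mem_span_pair] at hy
    obtain ⟨u, v, h⟩ := hy
    exact ⟨u, v, by rw [← h, Algebra.smul_def, Algebra.smul_def, mul_one]⟩
  have : Algebra.IsQuadraticExtension ℚ k := ⟨hk⟩
  obtain ⟨σ, hσ⟩ : ∃ σ : k ≃ₐ[ℚ] k, σ w ≠ w := by
    by_contra! h
    obtain ⟨q, hq⟩ := (IsGalois.mem_range_algebraMap_iff_fixed (w : k)).mpr h
    exact hnr q hq
  have hσw : σ w = -w := by
    have h : (σ w) ^ 2 = (w : k) ^ 2 := by rw [← map_pow, hwk, map_natCast]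
    exact (sq_eq_sq_iff_eq_or_eq_neg.mp h).resolve_left hσ
  obtain ⟨u, v, huv⟩ := hdec x
  have hσx : σ x = algebraMap ℚ k u - algebraMap ℚ k v * w := by
    rw [huv, map_add, map_mul, hσw, AlgEquiv.commutes, AlgEquiv.commutes]; ring
  have hrat : ∀ q : ℚ, IsIntegral ℤ (algebraMap ℚ k q) → ∃ n : ℤ, algebraMap ℚ k q = n := by
    intro q hq
    rw [isIntegral_algebraMap_iff (algebraMap ℚ k).injective] at hq
    obtain ⟨n, hn⟩ := IsIntegrallyClosed.isIntegral_iff.mp hq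
    exact ⟨n, by rw [← hn]; simp⟩
  have hxi : IsIntegral ℤ (x : k) := x.isIntegral_coe
  have hwi : IsIntegral ℤ (w : k) := w.isIntegral_coe
  have hσi : IsIntegral ℤ (σ x) := hxi.map (σ.toAlgHom.restrictScalars ℤ)
  -- For `x = u + v w`, the trace `2u` and `(x - σ x) w = 2 v m` are rational and integral, and `2 x
  -- w = 2u w + 2 v m`.
  obtain ⟨t, ht⟩ := hrat (2 * u) (by
    rw [show algebraMap ℚ k (2 * u) = x + σ x by rw [hσx, huv, map_mul, map_ofNat]; ring]
    exact hxi.add hσi)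
  obtain ⟨e, he⟩ := hrat (2 * v * m) (by
    rw [show algebraMap ℚ k (2 * v * m) = (x - σ x) * w by
      rw [hσx, huv, map_mul, map_mul, map_ofNat, map_natCast]
      linear_combination -2 * algebraMap ℚ k v * hwk]
    exact (hxi.sub hσi).mul hwi)
  refine ⟨t, e, ?_⟩
  apply RingOfIntegers.coe_injective
  rw [map_add, map_mul, map_mul, map_mul, map_ofNat, map_intCast, map_intCast]
  change (2 : k) * (x : k) * (w : k) = t * (w : k) + e
  rw [map_mul, map_ofNat] at ht
  rw [map_mul, map_mul, map_ofNat, map_natCast] at he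
  rw [← ht, ← he, huv]
  linear_combination 2 * algebraMap ℚ k v * hwk

open NumberField in
/-- The prime ideals above a prime `p` that splits in `ℚ(√m)` have degree one. -/
theorem exists_intCast_sub_mem {m : ℕ} (hm : m.Prime) {k : Type*} [Field k] [NumberField k]
    (hk : Module.finrank ℚ k = 2) {w : 𝓞 k} (hw : w ^ 2 = (m : 𝓞 k)) {P : Ideal (𝓞 k)}
    [P.IsPrime] {p : ℕ} [Fact p.Prime] (hp : (p : 𝓞 k) ∈ P) (hp2 : p ≠ 2)
    {s : ℤ} (hs0 : ¬ (p : ℤ) ∣ s) (hs : w - s ∈ P) (x : 𝓞 k) : ∃ n : ℤ, x - n ∈ P := by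
  have hpZ : Prime (p : ℤ) := Nat.prime_iff_prime_int.mp Fact.out
  obtain ⟨t, e, hte⟩ := exists_two_mul_mul_eq hm hk hw x
  have h2 : ¬ (p : ℤ) ∣ 2 := by
    intro h
    have := (Nat.prime_dvd_prime_iff_eq (Fact.out : p.Prime) Nat.prime_two).mp (by exact_mod_cast h)
    exact hp2 this
  have h2s : ¬ (p : ℤ) ∣ 2 * s := fun h => (hpZ.dvd_or_dvd h).elim h2 hs0
  obtain ⟨u, v, huv⟩ := hpZ.coprime_iff_not_dvd.mpr h2s
  -- Modulo `P`, `w ≡ s` gives `2 s x ≡ t s + e`, and `v` inverts `2 s` modulo `p`.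
  refine ⟨v * (t * s + e), ?_⟩
  have huv' : (u : 𝓞 k) * p + v * (2 * s) = 1 := by
    exact_mod_cast congrArg (Int.cast : ℤ → 𝓞 k) huv
  have : x - ((v * (t * s + e) : ℤ) : 𝓞 k) = x * u * p + (v * t - 2 * v * x) * (w - s) := by
    push_cast
    linear_combination v * hte - x * huv'
  rw [this]
  exact P.add_mem (P.mul_mem_left _ hp) (P.mul_mem_left _ hs)

theorem quadraticSymbol_eq_legendreSym {R : Type*} [CommRing R] [IsDedekindDomain R]
    {P : Ideal R} [P.IsPrime] (hP : P ≠ ⊥) {p : ℕ} [Fact p.Prime] (hp : (p : R) ∈ P)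
    (hdeg : ∀ x : R, ∃ n : ℤ, x - n ∈ P) {α : R} {n : ℤ} (hα : α - n ∈ P)
    (hn : ¬ (p : ℤ) ∣ n) : quadraticSymbol P α = legendreSym p n := by
  have hmk : Ideal.Quotient.mk P α = Ideal.Quotient.mk P n := Ideal.Quotient.eq.mpr hα
  have hαP : α ∉ P := by
    rw [← Ideal.Quotient.eq_zero_iff_mem, hmk, Ideal.Quotient.eq_zero_iff_mem,
      Ideal.intCast_mem_iff_dvd hp]
    exact hn
  have hn0 : (n : ZMod p) ≠ 0 := by rwa [Ne, ZMod.intCast_zmod_eq_zero_iff_dvd]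
  have hiff : IsSquare (Ideal.Quotient.mk P α) ↔ IsSquare (n : ZMod p) := by
    rw [hmk]
    constructor
    · rintro ⟨c, hc⟩
      obtain ⟨x, rfl⟩ := Ideal.Quotient.mk_surjective c
      obtain ⟨l, hl⟩ := hdeg x
      rw [Ideal.Quotient.eq.mpr hl, ← map_mul, Ideal.Quotient.eq] at hc
      have h : ((n - l * l : ℤ) : R) ∈ P := by simpa using hc
      rw [Ideal.intCast_mem_iff_dvd hp, ← ZMod.intCast_zmod_eq_zero_iff_dvd] at h
      refine ⟨l, ?_⟩
      push_cast at h
      exact sub_eq_zero.mp h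
    · rintro ⟨c, hc⟩
      obtain ⟨l, rfl⟩ := ZMod.intCast_surjective c
      refine ⟨Ideal.Quotient.mk P l, ?_⟩
      rw [← map_mul, Ideal.Quotient.eq]
      have h : ((n - l * l : ℤ) : ZMod p) = 0 := by
        push_cast
        exact sub_eq_zero.mpr hc
      rw [ZMod.intCast_zmod_eq_zero_iff_dvd, ← Ideal.intCast_mem_iff_dvd hp] at h
      simpa using h
  rw [quadraticSymbol_of_notMem hP hαP]
  split_ifs with h
  · exact ((legendreSym.eq_one_iff p hn0).mpr (hiff.mp h)).symm
  · exact ((legendreSym.eq_neg_one_iff p).mpr (fun h' => h (hiff.mpr h'))).symm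

/-! ### The choice between `A + B√m` and its conjugate. -/

/-- If `p` divided both, it would divide their sum `2A`, and also `C`, since their product is `m C²`
modulo `p`. -/
theorem not_dvd_add_mul_or_not_dvd_sub_mul {m : ℕ} {A B C : ℤ}
    (hABC : A ^ 2 = (m : ℤ) * (B ^ 2 + C ^ 2)) (hCA : IsCoprime C A)
    {p : ℕ} [Fact p.Prime] (hp2 : p ≠ 2) (hpm : ¬ (p : ℤ) ∣ m)
    {s : ℤ} (hs : s ^ 2 ≡ m [ZMOD p]) : ¬ (p : ℤ) ∣ A + B * s ∨ ¬ (p : ℤ) ∣ A + B * (-s) := by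
  have hpZ : Prime (p : ℤ) := Nat.prime_iff_prime_int.mp Fact.out
  by_contra! h
  have hC : (p : ℤ) ∣ C := by
    by_contra hC
    exact not_dvd_add_mul_of_not_dvd hABC hpm hC hs h.1
  have h2A : (p : ℤ) ∣ 2 * A := by
    have := dvd_add h.1 h.2
    rwa [show A + B * s + (A + B * -s) = 2 * A by ring] at this
  rcases hpZ.dvd_or_dvd h2A with h2 | hA
  · exact hp2 ((Nat.prime_dvd_prime_iff_eq Fact.out Nat.prime_two).mp (by exact_mod_cast h2))
  · exact hpZ.not_isUnit (hCA.isUnit_of_dvd' hC hA)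

theorem mainTheorem1 (m : ℕ) (hm : m.Prime) (hm4 : m % 4 = 1) (A B C : ℤ)
    (hABC : A ^ 2 = (m : ℤ) * (B ^ 2 + C ^ 2)) (hB : 2 ∣ B)
    (hAB : IsCoprime A B) (hBC : IsCoprime B C) (hCA : IsCoprime C A)
    (hAB4 : A + B ≡ 1 [ZMOD 4])
    (p : ℕ) [Fact p.Prime] (hp2 : p ≠ 2) (hmp : legendreSym p (m : ℤ) = 1) :
    -- the symbol modulo any prime ideal above `p` of the ring of integers of `k = ℚ(√m)`
    (∀ (k : Type*) [Field k] [NumberField k], Module.finrank ℚ k = 2 →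
      ∀ w : NumberField.RingOfIntegers k, w ^ 2 = (m : NumberField.RingOfIntegers k) →
      ∀ P : Ideal (NumberField.RingOfIntegers k), P.IsPrime →
        (p : NumberField.RingOfIntegers k) ∈ P →
        quadraticSymbol P ((A : NumberField.RingOfIntegers k) + B * w) = quarticSymbol p m) ∧
    -- the ordinary Legendre symbol, with `√m` read as a solution `s` of `s² ≡ m mod p`
    (∀ s : ℤ, s ^ 2 ≡ m [ZMOD p] → ¬ (p : ℤ) ∣ A + B * s →
      legendreSym p (A + B * s) = quarticSymbol p m) ∧
    -- such a solution with `p ∤ A + B s` exists, and every solution is such if `p ∤ C`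
    (∃ s : ℤ, s ^ 2 ≡ m [ZMOD p] ∧ ¬ (p : ℤ) ∣ A + B * s) ∧
    (¬ (p : ℤ) ∣ C → ∀ s : ℤ, s ^ 2 ≡ m [ZMOD p] → ¬ (p : ℤ) ∣ A + B * s) := by
  have : Fact m.Prime := ⟨hm⟩
  have hpm : ¬ (p : ℤ) ∣ m := by
    rw [← ZMod.intCast_zmod_eq_zero_iff_dvd, ← legendreSym.eq_zero_iff, hmp]
    exact one_ne_zero
  have : CharP (AlgebraicClosure (ZMod p)) p :=
    charP_of_injective_algebraMap (algebraMap (ZMod p) _).injective p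
  have hleg : ∀ s : ℤ, s ^ 2 ≡ m [ZMOD p] → ¬ (p : ℤ) ∣ A + B * s →
      legendreSym p (A + B * s) = quarticSymbol p m := fun s hs hns =>
    legendreSym_add_mul_eq_quarticSymbol (AlgebraicClosure (ZMod p)) hm4 hABC hB hBC hAB4 hp2 hmp
      hs hns
  obtain ⟨s, hs⟩ : ∃ s : ℤ, s ^ 2 ≡ m [ZMOD p] := by
    obtain ⟨c, hc⟩ := (legendreSym.eq_one_iff p
      (by rwa [Ne, ZMod.intCast_zmod_eq_zero_iff_dvd])).mp hmp
    obtain ⟨s, rfl⟩ := ZMod.intCast_surjective c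
    refine ⟨s, (ZMod.intCast_eq_intCast_iff _ _ p).mp ?_⟩
    rw [hc]
    push_cast
    ring
  refine ⟨?_, hleg, ?_, fun hC s hs => not_dvd_add_mul_of_not_dvd hABC hpm hC hs⟩
  · intro k _ _ hk w hw P hP hp
    have hPbot : P ≠ ⊥ := by
      rintro rfl
      exact (Fact.out : p.Prime).ne_zero (by exact_mod_cast (Ideal.mem_bot.mp hp))
    obtain ⟨s', hs's, hws⟩ := Ideal.exists_intCast_sub_mem_of_sq_eq (m := m) hp
      (by rw [hw, Int.cast_natCast]) hs
    have hs' : s' ^ 2 ≡ m [ZMOD p] := hs's ▸ hs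
    have hs0 : ¬ (p : ℤ) ∣ s' := by
      intro h
      exact hpm (by simpa using dvd_add hs'.dvd (h.trans (dvd_pow_self s' two_ne_zero)))
    have hdeg := exists_intCast_sub_mem hm hk hw hp hp2 hs0 hws
    rcases not_dvd_add_mul_or_not_dvd_sub_mul hABC hCA hp2 hpm hs' with hns | hns
    · rw [← hleg s' hs' hns]
      refine quadraticSymbol_eq_legendreSym hPbot hp hdeg ?_ hns
      push_cast
      rw [show (A : NumberField.RingOfIntegers k) + B * w - (A + B * s') = B * (w - s') by ring]
      exact P.mul_mem_left _ hws
    · have hmem : (A : NumberField.RingOfIntegers k) - B * w - ((A + B * (-s') : ℤ) :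
          NumberField.RingOfIntegers k) ∈ P := by
        push_cast
        rw [show (A : NumberField.RingOfIntegers k) - B * w - (A + B * (-s')) = -B * (w - s') by
          ring]
        exact P.mul_mem_left _ hws
      have hABk : (A : NumberField.RingOfIntegers k) ^ 2 = m * (B ^ 2 + C ^ 2) := by
        exact_mod_cast congrArg (Int.cast : ℤ → NumberField.RingOfIntegers k) hABC
      have hw0 : w ≠ 0 := by
        rintro rfl
        rw [zero_pow two_ne_zero] at hw
        exact hm.ne_zero (by exact_mod_cast hw.symm)
      have hC0 : (C : NumberField.RingOfIntegers k) ≠ 0 := by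
        intro h
        have hC : C = 0 := by exact_mod_cast h
        rw [hC, isCoprime_zero_left] at hCA
        have hmA : (m : ℤ) ∣ A :=
          (Nat.prime_iff_prime_int.mp hm).dvd_of_dvd_pow (n := 2) ⟨_, hABC⟩
        exact (Nat.prime_iff_prime_int.mp hm).not_isUnit (isUnit_of_dvd_unit hmA hCA)
      have hne : (A : NumberField.RingOfIntegers k) - B * w ≠ 0 := by
        intro h
        rw [h, zero_sub, P.neg_mem_iff, Ideal.intCast_mem_iff_dvd hp] at hmem
        exact hns hmem
      have hclass : SameSquareClass ((A : NumberField.RingOfIntegers k) + B * w) (A - B * w) := by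
        -- From `(A + B w)(A - B w) = m C² = (C w)²`.
        refine ⟨A - B * w, C * w, hne, mul_ne_zero hC0 hw0, ?_⟩
        linear_combination (A - B * w) * (hABk - (B ^ 2 + C ^ 2) * hw)
      rw [quadraticSymbol_congr P hclass, ← hleg (-s') (by rwa [neg_sq]) hns]
      exact quadraticSymbol_eq_legendreSym hPbot hp hdeg hmem hns
  · rcases not_dvd_add_mul_or_not_dvd_sub_mul hABC hCA hp2 hpm hs with h | h
    · exact ⟨s, hs, h⟩
    · exact ⟨-s, by rwa [neg_sq], h⟩
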